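/- Let $N\ge 1$ and equip $\mathbb{R}^N$ with the Euclidean norm. Let $A$ be a real $N\times N$ matrix with transpose $A^*$ such that $A^*A$ is positive definite, and let $\lambda_1>0$ be the smallest eigenvalue of $A^*A$. Let $F:\mathbb{R}^N\to\mathbb{R}^N$ be locally Lipschitz. For $x\in\mathbb{R}^N$ let $\partial F(x)$ denote the generalized Jacobian of $F$ at $x$ in the sense of Clarke, that is, the convex hull of the set of all matrices $Z$ of the form $Z=\lim_{k\to\infty}JF(x_k)$, where $x_k\to x$, $F$ is differentiable at every $x_k$, and $JF(x_k)$ is the Jacobian matrix of $F$ at $x_k$. Assume that (i) there are constants $0<a<\sqrt{\lambda_1}$ and $R$ such that $\|F(x)\|\le a\|x\|$ for all $x\in\mathbb{R}^N$ with $\|x\|\ge R$; (ii) $\det(A-B)\neq 0$ for every $x\in\mathbb{R}^N$ and every $B\in\partial F(x)$. Then for every $\xi\in\mathbb{R}^N$ the equation $Ax=F(x)+\xi$ has exactly one solution $x\in\mathbb{R}^N$. -/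

import Mathlib

open Filter Topology

/-- The Jacobian matrix of `F : ℝⁿ → ℝᵐ` at `u`: the entry `(i, j)` is the partial derivative
of the `i`-th component in the `j`-th coordinate direction. It is used below only at points
where `F` is differentiable. -/
noncomputable def jacobianMatrix {n m : ℕ}
    (F : EuclideanSpace ℝ (Fin n) → EuclideanSpace ℝ (Fin m)) (u : EuclideanSpace ℝ (Fin n)) :
    Matrix (Fin m) (Fin n) ℝ :=
  Matrix.of fun i j => fderiv ℝ F u (EuclideanSpace.single j 1) i

/-- The set of all limits of Jacobian matrices along sequences of points of differentiability
of `F` that converge to `x`. -/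
def limitingJacobian {n m : ℕ}
    (F : EuclideanSpace ℝ (Fin n) → EuclideanSpace ℝ (Fin m)) (x : EuclideanSpace ℝ (Fin n)) :
    Set (Matrix (Fin m) (Fin n) ℝ) :=
  {Z | ∃ u : ℕ → EuclideanSpace ℝ (Fin n),
    (∀ k, DifferentiableAt ℝ F (u k)) ∧ Tendsto u atTop (𝓝 x) ∧
      Tendsto (fun k => jacobianMatrix F (u k)) atTop (𝓝 Z)}

/-- Clarke's generalized Jacobian `∂F(x)`: the convex hull of all limits of Jacobian matrices at
points of differentiability that converge to `x`. -/
def generalizedJacobian {n m : ℕ}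
    (F : EuclideanSpace ℝ (Fin n) → EuclideanSpace ℝ (Fin m)) (x : EuclideanSpace ℝ (Fin n)) :
    Set (Matrix (Fin m) (Fin n) ℝ) :=
  convexHull ℝ (limitingJacobian F x)

/-! Put `G = A - F`; the claim is that `G` is bijective. The growth bound gives `‖G u‖ ≥ (√λ₁ - a)
‖u‖` far out, so `G` is proper. If `G` is also a local homeomorphism, it is a covering of a simply
connected space by a connected one, hence bijective.

The local part replaces the inverse function theorem. Near `x` the derivatives of `G`, where they
exist, lie in a compact convex set `K` of invertible operators. For `v ≠ 0` the compact convex set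
`K v` omits `0` and is separated from it; with a mean value inequality this gives local injectivity.
Separation for the adjoints of `K` gives a descent direction for `‖G u - y‖` wherever `G u ≠ y`, so
interior minimizers solve `G u = y` and `G` is open. -/

/-! ### Mean value inequalities for Lipschitz maps -/

open Metric Set MeasureTheory in
/-- Mean value inequality for Lipschitz functions on a convex open set, with the bound on the
derivative required only almost everywhere. -/
theorem LipschitzWith.le_sub_of_ae_le_fderiv {E : Type*} [NormedAddCommGroup E] [NormedSpace ℝ E]
    [FiniteDimensional ℝ E] [MeasurableSpace E] [BorelSpace E] {μ : Measure E}
    [μ.IsAddHaarMeasure] {C : NNReal} {f : E → ℝ} (hf : LipschitzWith C f) {U : Set E}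
    (hU : IsOpen U) (hUc : Convex ℝ U) {x d : E} (hx : x ∈ U) (hxd : x + d ∈ U) {c : ℝ}
    (h : ∀ᵐ u ∂μ, u ∈ U → c ≤ fderiv ℝ f u d) : c ≤ f (x + d) - f x := by
  by_contra! hlt
  -- The segment from `x` to `x + d` may miss every point of differentiability. The strict gap `c' <
  -- c` survives moving `x` in a small ball, and averaging over that ball makes the a.e. bound
  -- usable at every `t`.
  obtain ⟨c', hc', hc'c⟩ := exists_between hlt
  have hW : ∀ᶠ u in 𝓝 x, u ∈ U ∧ u + d ∈ U ∧ f (u + d) - f u < c' := by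
    have h1 : ContinuousAt (fun u => u + d) x := by fun_prop
    have h2 : ContinuousAt (fun u => f (u + d) - f u) x := by
      have := hf.continuous
      fun_prop
    exact (hU.eventually_mem hx).and ((h1.eventually (hU.eventually_mem hxd)).and
      (h2.eventually (gt_mem_nhds hc')))
  obtain ⟨ρ, hρ, hB⟩ := nhds_basis_closedBall.eventually_iff.1 hW
  set B := closedBall x ρ
  have hBc : IsCompact B := isCompact_closedBall x ρ
  have hBfin : μ B ≠ ⊤ := hBc.measure_lt_top.ne
  have hBpos : 0 < μ.real B := ENNReal.toReal_pos (measure_closedBall_pos μ x hρ).ne' hBfin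
  have hint (t : ℝ) : IntegrableOn (fun u => f (u + t • d)) B μ := by
    have := hf.continuous
    exact ContinuousOn.integrableOn_compact hBc (by fun_prop)
  have hderiv (t : ℝ) : IntegrableOn (fun u => fderiv ℝ f (u + t • d) d) B μ ∧
      HasDerivAt (fun t : ℝ => ∫ u in B, f (u + t • d) ∂μ)
        (∫ u in B, fderiv ℝ f (u + t • d) d ∂μ) t := by
    refine hasDerivAt_integral_of_dominated_loc_of_lip (bound := fun _ => C * ‖d‖) (s := univ)
      univ_mem (Eventually.of_forall fun s => (hint s).aestronglyMeasurable) (hint t) ?_ ?_ ?_ ?_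
    · exact (((measurable_fderiv_apply_const ℝ f d).comp
        (measurable_add_const (t • d))).stronglyMeasurable).aestronglyMeasurable
    · refine Eventually.of_forall fun u => LipschitzOnWith.of_dist_le_mul fun s _ s' _ => ?_
      refine (hf.dist_le_mul _ _).trans (le_of_eq ?_)
      rw [dist_add_left, dist_eq_norm, ← sub_smul, norm_smul, Real.coe_nnabs,
        abs_of_nonneg (by positivity), dist_eq_norm]
      ring
    · exact integrableOn_const hBfin
    · refine ae_restrict_of_ae ?_
      have hq := (measurePreserving_add_right μ (t • d)).quasiMeasurePreserving.ae
        (hf.ae_differentiableAt (μ := μ))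
      filter_upwards [hq] with u hu
      have hl : HasDerivAt (fun s : ℝ => u + s • d) d t := by
        simpa using ((hasDerivAt_id t).smul_const d).const_add u
      exact hu.hasFDerivAt.comp_hasDerivAt t hl
  have hlow (t : ℝ) (ht : t ∈ Icc (0 : ℝ) 1) :
      c * μ.real B ≤ ∫ u in B, fderiv ℝ f (u + t • d) d ∂μ := by
    have hq := (measurePreserving_add_right μ (t • d)).quasiMeasurePreserving.ae h
    have : ∫ _u in B, c ∂μ ≤ ∫ u in B, fderiv ℝ f (u + t • d) d ∂μ := by
      refine setIntegral_mono_on_ae (integrableOn_const hBfin) (hderiv t).1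
        measurableSet_closedBall ?_
      filter_upwards [hq] with u hu huB
      refine hu ?_
      have := hUc (hB huB).1 (hB huB).2.1 (sub_nonneg.2 ht.2) ht.1 (by ring)
      convert! this using 1
      module
    simpa [mul_comm] using this
  have hmv : c * μ.real B ≤ (∫ u in B, f (u + (1 : ℝ) • d) ∂μ) -
      ∫ u in B, f (u + (0 : ℝ) • d) ∂μ := by
    have := (convex_Icc (0 : ℝ) 1).mul_sub_le_image_sub_of_le_deriv
      (f := fun t : ℝ => ∫ u in B, f (u + t • d) ∂μ) (C := c * μ.real B)
      (fun t _ => (hderiv t).2.continuousAt.continuousWithinAt)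
      (fun t _ => (hderiv t).2.differentiableAt.differentiableWithinAt)
      (fun t ht => by rw [(hderiv t).2.deriv]; exact hlow t (interior_subset ht))
      0 (by simp) 1 (by simp) zero_le_one
    simpa using this
  have hup : (∫ u in B, f (u + (1 : ℝ) • d) ∂μ) - ∫ u in B, f (u + (0 : ℝ) • d) ∂μ
      ≤ c' * μ.real B := by
    rw [← integral_sub (hint 1) (hint 0)]
    have : ∫ u in B, (f (u + (1 : ℝ) • d) - f (u + (0 : ℝ) • d)) ∂μ ≤ ∫ _u in B, c' ∂μ :=
      setIntegral_mono_on ((hint 1).sub (hint 0)) (integrableOn_const hBfin)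
        measurableSet_closedBall fun u hu => by simpa using (hB hu).2.2.le
    simpa [mul_comm] using this
  nlinarith

open Metric Set MeasureTheory in
/-- Mean value inequality for a locally Lipschitz map, tested against a fixed vector, with the bound
required at the points of differentiability. -/
theorem LipschitzOnWith.le_inner_sub_of_le_inner_fderiv {E F : Type*} [NormedAddCommGroup E]
    [NormedSpace ℝ E] [FiniteDimensional ℝ E] [NormedAddCommGroup F] [InnerProductSpace ℝ F]
    [FiniteDimensional ℝ F] {C : NNReal} {G : E → F} {U : Set E} (hG : LipschitzOnWith C G U)
    (hU : IsOpen U) (hUc : Convex ℝ U) {x d : E} (hx : x ∈ U) (hxd : x + d ∈ U) {w : F} {c : ℝ}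
    (h : ∀ u ∈ U, DifferentiableAt ℝ G u → c ≤ inner ℝ w (fderiv ℝ G u d)) :
    c ≤ inner ℝ w (G (x + d) - G x) := by
  borelize E
  -- A global Lipschitz extension agrees with `G` on the open set `U`, hence has the same
  -- derivatives there.
  obtain ⟨g, hg, hgG⟩ := hG.extend_finite_dimension
  have hf : LipschitzWith (‖innerSL ℝ w‖₊ * (lipschitzExtensionConstant F * C))
      (fun u => innerSL ℝ w (g u)) := (innerSL ℝ w).lipschitz.comp hg
  have := hf.le_sub_of_ae_le_fderiv (μ := Measure.addHaar) hU hUc hx hxd (c := c) ?_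
  · simpa [hgG hx, hgG hxd, inner_sub_right] using this
  filter_upwards [hg.ae_differentiableAt (μ := Measure.addHaar)] with u hu huU
  have heq : G =ᶠ[𝓝 u] g := hgG.eventuallyEq_of_mem (hU.mem_nhds huU)
  have h1 : HasFDerivAt (fun u => innerSL ℝ w (g u)) ((innerSL ℝ w).comp (fderiv ℝ g u)) u :=
    (innerSL ℝ w).hasFDerivAt.comp u hu.hasFDerivAt
  have := h u huU (heq.differentiableAt_iff.2 hu)
  rw [heq.fderiv_eq] at this
  rw [h1.fderiv]
  simpa using this

/-! ### Compactness and limiting derivatives -/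

open Set in
/-- In a finite-dimensional space the convex hull of a compact set is compact. -/
theorem IsCompact.convexHull_of_finiteDimensional {E : Type*} [NormedAddCommGroup E]
    [NormedSpace ℝ E] [FiniteDimensional ℝ E] {s : Set E} (hs : IsCompact s) :
    IsCompact (convexHull ℝ s) := by
  -- Carathéodory: boundedly many points suffice, so the hull is a finite union of continuous images
  -- of compact sets.
  have key : convexHull ℝ s = ⋃ n ∈ Iic (Module.finrank ℝ E + 1),
      (fun p : (Fin n → ℝ) × (Fin n → E) => ∑ i, p.1 i • p.2 i) ''
        (stdSimplex ℝ (Fin n) ×ˢ univ.pi fun _ => s) := by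
    apply Subset.antisymm
    · intro x hx
      obtain ⟨ι, _, z, w, hz, hai, hw, hw1, rfl⟩ := eq_pos_convex_span_of_mem_convexHull hx
      simp only [mem_iUnion]
      refine ⟨Fintype.card ι, ?_, ?_⟩
      · exact hai.card_le_finrank_succ.trans (by gcongr; exact Submodule.finrank_le _)
      · let e := (Fintype.equivFin ι).symm
        refine ⟨(w ∘ e, z ∘ e), ⟨⟨fun i => (hw _).le, ?_⟩, fun i _ => hz ⟨_, rfl⟩⟩, ?_⟩
        · simpa [hw1] using e.sum_comp w
        · exact e.sum_comp fun i => w i • z i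
    · simp only [iUnion_subset_iff]
      rintro n - x ⟨⟨w, z⟩, ⟨⟨hw, hw1⟩, hz⟩, rfl⟩
      exact mem_convexHull_of_exists_fintype w z hw hw1 (fun i => hz i (mem_univ i)) rfl
  rw [key]
  refine (finite_Iic _).isCompact_biUnion fun n _ => ?_
  exact ((isCompact_stdSimplex ℝ (Fin n)).prod (isCompact_univ_pi fun _ => hs)).image
    (by fun_prop)

/-- The limits of derivatives of `G` at points of differentiability converging to `x`. -/
def limitingFDeriv {E F : Type*} [NormedAddCommGroup E] [NormedSpace ℝ E] [NormedAddCommGroup F]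
    [NormedSpace ℝ F] (G : E → F) (x : E) : Set (E →L[ℝ] F) :=
  {T | MapClusterPt T (𝓝 x ⊓ 𝓟 {u | DifferentiableAt ℝ G u}) (fderiv ℝ G)}

section limitingFDeriv

variable {E F : Type*} [NormedAddCommGroup E] [NormedSpace ℝ E] [NormedAddCommGroup F]
  [NormedSpace ℝ F] {G : E → F} {x : E}

theorem exists_seq_of_mem_limitingFDeriv {T : E →L[ℝ] F} (hT : T ∈ limitingFDeriv G x) :
    ∃ u : ℕ → E, (∀ k, DifferentiableAt ℝ G (u k)) ∧ Tendsto u atTop (𝓝 x) ∧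
      Tendsto (fun k => fderiv ℝ G (u k)) atTop (𝓝 T) := by
  have : (comap (fderiv ℝ G) (𝓝 T) ⊓ (𝓝 x ⊓ 𝓟 {u | DifferentiableAt ℝ G u})).NeBot := by
    rw [← map_neBot_iff (f := fderiv ℝ G), Filter.push_pull']
    exact hT
  obtain ⟨u, hu⟩ := exists_seq_tendsto
    (comap (fderiv ℝ G) (𝓝 T) ⊓ (𝓝 x ⊓ 𝓟 {u | DifferentiableAt ℝ G u}))
  rw [tendsto_inf, tendsto_inf, tendsto_comap_iff, tendsto_principal] at hu
  obtain ⟨h1, h2, h3⟩ := hu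
  obtain ⟨n, hn⟩ := eventually_atTop.1 h3
  refine ⟨fun k => u (k + n), fun k => hn _ (by omega), ?_, ?_⟩
  · exact h2.comp (tendsto_add_atTop_nat n)
  · exact h1.comp (tendsto_add_atTop_nat n)

theorem LocallyLipschitz.eventually_norm_fderiv_le (hG : LocallyLipschitz G) (x : E) :
    ∃ C : ℝ, ∀ᶠ u in 𝓝 x, ‖fderiv ℝ G u‖ ≤ C := by
  obtain ⟨C, t, ht, hC⟩ := hG x
  refine ⟨C, ?_⟩
  filter_upwards [eventually_mem_nhds_iff.2 ht] with u hu
  exact norm_fderiv_le_of_lipschitzOn ℝ hu hC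

theorem LocallyLipschitz.isCompact_limitingFDeriv [FiniteDimensional ℝ E] [FiniteDimensional ℝ F]
    (hG : LocallyLipschitz G) (x : E) : IsCompact (limitingFDeriv G x) := by
  obtain ⟨C, hC⟩ := hG.eventually_norm_fderiv_le x
  have : ProperSpace (E →L[ℝ] F) := FiniteDimensional.proper ℝ _
  refine (isCompact_closedBall (0 : E →L[ℝ] F) C).of_isClosed_subset isClosed_setOfPred_clusterPt ?_
  intro T hT
  refine Metric.isClosed_closedBall.mem_of_mapClusterPt hT ?_
  filter_upwards [hC.filter_mono inf_le_left] with u hu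
  simpa using hu

/-- Upper semicontinuity: derivatives near `x` are bounded, so if they kept leaving `V` they would
have a cluster point outside `V`. -/
theorem LocallyLipschitz.eventually_fderiv_mem [FiniteDimensional ℝ E] [FiniteDimensional ℝ F]
    (hG : LocallyLipschitz G) {V : Set (E →L[ℝ] F)} (hV : IsOpen V)
    (hGV : limitingFDeriv G x ⊆ V) :
    ∀ᶠ u in 𝓝 x, DifferentiableAt ℝ G u → fderiv ℝ G u ∈ V := by
  obtain ⟨C, hC⟩ := hG.eventually_norm_fderiv_le x
  have : ProperSpace (E →L[ℝ] F) := FiniteDimensional.proper ℝ _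
  by_contra hcon
  have hfreq : ∃ᶠ u in 𝓝 x ⊓ 𝓟 {u | DifferentiableAt ℝ G u},
      fderiv ℝ G u ∈ Metric.closedBall (0 : E →L[ℝ] F) C ∩ Vᶜ := by
    rw [frequently_inf_principal]
    refine ((not_eventually.1 hcon).and_eventually hC).mono ?_
    rintro u ⟨hu, huC⟩
    push Not at hu
    exact ⟨hu.1, by simpa using huC, hu.2⟩
  obtain ⟨T, hT, hcl⟩ := ((isCompact_closedBall (0 : E →L[ℝ] F) C).inter_right
    hV.isClosed_compl).exists_mapClusterPt_of_frequently hfreq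
  exact hT.2 (hGV hcl)

end limitingFDeriv

/-! ### Local inversion -/

/-- A compact convex set avoiding `0` lies strictly on one side of a hyperplane normal to one
of its directions. -/
theorem exists_norm_sq_le_inner_of_zero_notMem {E : Type*} [NormedAddCommGroup E]
    [InnerProductSpace ℝ E] {K : Set E} (hK : IsCompact K) (hKc : Convex ℝ K)
    (hKn : K.Nonempty) (h0 : (0 : E) ∉ K) : ∃ p : E, p ≠ 0 ∧ ∀ z ∈ K, ‖p‖ ^ 2 ≤ inner ℝ p z := by
  obtain ⟨p, hp, hmin⟩ := exists_norm_eq_iInf_of_complete_convex hKn hK.isComplete hKc 0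
  rw [norm_eq_iInf_iff_real_inner_le_zero hKc hp] at hmin
  refine ⟨p, fun h => h0 (h ▸ hp), fun z hz => ?_⟩
  have := hmin z hz
  rw [zero_sub, inner_neg_left, inner_sub_right, real_inner_self_eq_norm_sq] at this
  linarith

section Local

variable {E : Type*} [NormedAddCommGroup E] [InnerProductSpace ℝ E] [FiniteDimensional ℝ E]
  {G : E → E} {x : E}

/-- Invertibility is an open condition, so a small closed thickening of the compact hull still
consists of invertible operators. -/
theorem LocallyLipschitz.exists_convex_isUnit_fderiv_mem (hG : LocallyLipschitz G)
    (hunit : ∀ T ∈ convexHull ℝ (limitingFDeriv G x), IsUnit T) :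
    ∃ K : Set (E →L[ℝ] E), IsCompact K ∧ Convex ℝ K ∧ (∀ T ∈ K, IsUnit T) ∧
      ∀ᶠ u in 𝓝 x, DifferentiableAt ℝ G u → fderiv ℝ G u ∈ K := by
  have : ProperSpace (E →L[ℝ] E) := FiniteDimensional.proper ℝ _
  have : CompleteSpace E := FiniteDimensional.complete ℝ E
  have hc := (hG.isCompact_limitingFDeriv x).convexHull_of_finiteDimensional
  obtain ⟨δ, hδ, hsub⟩ := hc.exists_cthickening_subset_open Units.isOpen hunit
  refine ⟨Metric.cthickening δ (convexHull ℝ (limitingFDeriv G x)), hc.cthickening,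
    (convex_convexHull ℝ _).cthickening δ, hsub, ?_⟩
  have h := hG.eventually_fderiv_mem (x := x)
    (Metric.isOpen_thickening (δ := δ) (E := convexHull ℝ (limitingFDeriv G x)))
    ((subset_convexHull ℝ _).trans (Metric.self_subset_thickening hδ _))
  filter_upwards [h] with u hu hd
  exact Metric.thickening_subset_cthickening _ _ (hu hd)

omit [FiniteDimensional ℝ E] in
theorem ContinuousLinearMap.exists_forall_norm_sq_le_inner_apply {K : Set (E →L[ℝ] E)}
    (hK : IsCompact K) (hKc : Convex ℝ K) (hu : ∀ T ∈ K, IsUnit T) {v : E} (hv : v ≠ 0) :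
    ∃ p : E, p ≠ 0 ∧ ∀ T ∈ K, ‖p‖ ^ 2 ≤ inner ℝ p (T v) := by
  obtain rfl | hne := K.eq_empty_or_nonempty
  · exact ⟨v, hv, by simp⟩
  let ev : (E →L[ℝ] E) →L[ℝ] E := ContinuousLinearMap.apply ℝ E v
  have h0 : (0 : E) ∉ ev '' K := by
    rintro ⟨T, hT, h0⟩
    obtain ⟨S, hS⟩ := (hu T hT).exists_left_inv
    refine hv ?_
    have h1 : S (T v) = v := by simpa using congrArg (fun A : E →L[ℝ] E => A v) hS
    have h2 : T v = 0 := h0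
    rw [← h1, h2, map_zero]
  obtain ⟨p, hp, h⟩ := exists_norm_sq_le_inner_of_zero_notMem (hK.image ev.continuous)
    (hKc.linear_image ev.toLinearMap) (hne.image ev) h0
  exact ⟨p, hp, fun T hT => h _ ⟨T, hT, rfl⟩⟩

theorem ContinuousLinearMap.exists_forall_norm_sq_le_inner_apply' {K : Set (E →L[ℝ] E)}
    (hK : IsCompact K) (hKc : Convex ℝ K) (hu : ∀ T ∈ K, IsUnit T) {v : E} (hv : v ≠ 0) :
    ∃ p : E, p ≠ 0 ∧ ∀ T ∈ K, ‖p‖ ^ 2 ≤ inner ℝ v (T p) := by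
  have : CompleteSpace E := FiniteDimensional.complete ℝ E
  have hlin : IsLinearMap ℝ fun T : E →L[ℝ] E => ContinuousLinearMap.adjoint T :=
    ⟨fun S T => map_add _ S T, fun c T => by simp⟩
  have hu' : ∀ T ∈ (fun T : E →L[ℝ] E => ContinuousLinearMap.adjoint T) '' K, IsUnit T := by
    rintro _ ⟨T, hT, rfl⟩
    exact (hu T hT).star
  obtain ⟨p, hp, h⟩ := exists_forall_norm_sq_le_inner_apply
    (hK.image ContinuousLinearMap.adjoint.continuous) (hKc.is_linear_image hlin) hu' hv
  refine ⟨p, hp, fun T hT => ?_⟩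
  have := h _ ⟨T, hT, rfl⟩
  rwa [ContinuousLinearMap.adjoint_inner_right, real_inner_comm] at this

theorem LocallyLipschitz.exists_ball_lipschitz_fderiv_mem (hG : LocallyLipschitz G)
    (hunit : ∀ T ∈ convexHull ℝ (limitingFDeriv G x), IsUnit T) :
    ∃ K : Set (E →L[ℝ] E), IsCompact K ∧ Convex ℝ K ∧ (∀ T ∈ K, IsUnit T) ∧
      ∃ C, ∃ r > 0, LipschitzOnWith C G (Metric.ball x r) ∧
        ∀ u ∈ Metric.ball x r, DifferentiableAt ℝ G u → fderiv ℝ G u ∈ K := by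
  obtain ⟨K, hK, hKc, hu, hev⟩ := hG.exists_convex_isUnit_fderiv_mem hunit
  obtain ⟨C, t, ht, hC⟩ := hG x
  obtain ⟨r, hr, hb⟩ := Metric.nhds_basis_ball.eventually_iff.1 (hev.and ht)
  exact ⟨K, hK, hKc, hu, C, r, hr, hC.mono fun u hu => (hb hu).2, fun u hu => (hb hu).1⟩

/-- A locally Lipschitz map whose generalized derivative at `x` is nonsingular is injective
near `x`. -/
theorem LocallyLipschitz.exists_injOn_ball (hG : LocallyLipschitz G)
    (hunit : ∀ T ∈ convexHull ℝ (limitingFDeriv G x), IsUnit T) :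
    ∃ r > 0, Set.InjOn G (Metric.ball x r) := by
  obtain ⟨K, hK, hKc, hu, C, r, hr, hC, hd⟩ := hG.exists_ball_lipschitz_fderiv_mem hunit
  refine ⟨r, hr, fun a ha b hb hab => ?_⟩
  by_contra hne
  obtain ⟨p, hp, h⟩ := ContinuousLinearMap.exists_forall_norm_sq_le_inner_apply hK hKc hu
    (sub_ne_zero.2 (Ne.symm hne))
  have := hC.le_inner_sub_of_le_inner_fderiv Metric.isOpen_ball (convex_ball x r) ha
    (d := b - a) (by simpa using hb) (w := p) (c := ‖p‖ ^ 2) fun u hu hdu => h _ (hd u hu hdu)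
  rw [add_sub_cancel, hab, sub_self, inner_zero_right] at this
  have := pow_pos (norm_pos_iff.2 hp) 2
  linarith

/-- If the generalized derivative of `G` at `x` is nonsingular, then `x` is a local minimum of the
distance to `y` only if `G x = y`. -/
theorem LocallyLipschitz.eq_of_isLocalMin_norm_sub (hG : LocallyLipschitz G)
    (hunit : ∀ T ∈ convexHull ℝ (limitingFDeriv G x), IsUnit T) {y : E}
    (hmin : IsLocalMin (fun u => ‖G u - y‖) x) : G x = y := by
  obtain ⟨K, hK, hKc, hu, C, r, hr, hC, hd⟩ := hG.exists_ball_lipschitz_fderiv_mem hunit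
  by_contra hne
  obtain ⟨p, hp, h⟩ := ContinuousLinearMap.exists_forall_norm_sq_le_inner_apply' hK hKc hu
    (sub_ne_zero.2 hne)
  have hp2 := pow_pos (norm_pos_iff.2 hp) 2
  have hcont : ContinuousAt (fun t : ℝ => x - t • p) 0 := by fun_prop
  have hcont' : Tendsto (fun t : ℝ => x - t • p) (𝓝[>] 0) (𝓝 x) := by
    simpa using hcont.tendsto.mono_left nhdsWithin_le_nhds
  -- Moving to `x - t • p` changes the squared distance to `y` by at most `-2t‖p‖² + C²t²‖p‖²`,
  -- negative for such `t`.
  have hsmall : ∀ᶠ t : ℝ in 𝓝[>] 0, C ^ 2 * t < 2 := by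
    have : Tendsto (fun t : ℝ => (C : ℝ) ^ 2 * t) (𝓝[>] 0) (𝓝 0) := by
      have : ContinuousAt (fun t : ℝ => (C : ℝ) ^ 2 * t) 0 := by fun_prop
      simpa using this.tendsto.mono_left nhdsWithin_le_nhds
    exact this.eventually (gt_mem_nhds two_pos)
  obtain ⟨t, ⟨⟨hmint, hball⟩, hs⟩, ht⟩ := (((hcont'.eventually hmin).and
    (hcont'.eventually (Metric.ball_mem_nhds x hr))).and hsmall).and self_mem_nhdsWithin |>.exists
  have ht : 0 < t := ht
  have hmv := hC.le_inner_sub_of_le_inner_fderiv Metric.isOpen_ball (convex_ball x r) hball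
    (d := t • p) (by simpa using hr) (w := G x - y) (c := t * ‖p‖ ^ 2) fun u hu hdu => by
      rw [map_smul, inner_smul_right]
      exact mul_le_mul_of_nonneg_left (h _ (hd u hu hdu)) ht.le
  rw [sub_add_cancel] at hmv
  have hlip := hC.norm_sub_le (Metric.mem_ball_self hr) hball
  rw [sub_sub_cancel, norm_smul, Real.norm_of_nonneg ht.le] at hlip
  have hexp : ‖G (x - t • p) - y‖ ^ 2 = ‖G x - y‖ ^ 2 -
      2 * inner ℝ (G x - y) (G x - G (x - t • p)) + ‖G x - G (x - t • p)‖ ^ 2 := by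
    rw [← norm_sub_sq_real]
    congr 2
    abel
  have h1 : ‖G x - y‖ ^ 2 ≤ ‖G (x - t • p) - y‖ ^ 2 := pow_le_pow_left₀ (norm_nonneg _) hmint 2
  have h2 : ‖G x - G (x - t • p)‖ ^ 2 ≤ (C * (t * ‖p‖)) ^ 2 :=
    pow_le_pow_left₀ (norm_nonneg _) hlip 2
  have h3 : C ^ 2 * t * (t * ‖p‖ ^ 2) < 2 * (t * ‖p‖ ^ 2) :=
    mul_lt_mul_of_pos_right hs (mul_pos ht hp2)
  nlinarith

theorem LocallyLipschitz.nhds_le_map_nhds (hG : LocallyLipschitz G)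
    (hunit : ∀ u, ∀ T ∈ convexHull ℝ (limitingFDeriv G u), IsUnit T) (x : E) :
    𝓝 (G x) ≤ map G (𝓝 x) := by
  have : ProperSpace E := FiniteDimensional.proper ℝ E
  intro s hs
  obtain ⟨r₁, hr₁, hinj⟩ := hG.exists_injOn_ball (hunit x)
  obtain ⟨r₂, hr₂, hsub⟩ := Metric.mem_nhds_iff.1 (mem_map.1 hs)
  obtain ⟨r, hr, hrlt⟩ := exists_between (lt_min hr₁ hr₂)
  have hrlt₁ := hrlt.trans_le (min_le_left _ _)
  have hrlt₂ := hrlt.trans_le (min_le_right _ _)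
  obtain ⟨m, hm, hsph⟩ : ∃ m > 0, ∀ u ∈ Metric.sphere x r, m ≤ ‖G u - G x‖ := by
    obtain hempty | hne := (Metric.sphere x r).eq_empty_or_nonempty
    · exact ⟨1, one_pos, by simp [hempty]⟩
    obtain ⟨u, hu, hmin⟩ := (isCompact_sphere x r).exists_isMinOn hne
      (f := fun u => ‖G u - G x‖) (by have := hG.continuous; fun_prop)
    refine ⟨_, norm_pos_iff.2 (sub_ne_zero.2 fun h => ?_), hmin⟩
    have hux := hinj (Metric.sphere_subset_closedBall.trans
      (Metric.closedBall_subset_ball hrlt₁) hu) (Metric.mem_ball_self hr₁) h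
    rw [hux, Metric.mem_sphere, dist_self] at hu
    exact hr.ne hu
  -- Within `m / 2` of `G x`, the center beats every point of the sphere, so the minimizer over the
  -- closed ball is interior.
  filter_upwards [Metric.ball_mem_nhds (G x) (half_pos hm)] with y hy
  rw [Metric.mem_ball', dist_eq_norm] at hy
  obtain ⟨u, hu, hmin⟩ := (isCompact_closedBall x r).exists_isMinOn
    ⟨x, Metric.mem_closedBall_self hr.le⟩ (f := fun u => ‖G u - y‖)
    (by have := hG.continuous; fun_prop)
  have hux : ‖G u - y‖ ≤ ‖G x - y‖ := hmin (Metric.mem_closedBall_self hr.le)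
  have hball : u ∈ Metric.ball x r := by
    refine lt_of_le_of_ne (Metric.mem_closedBall.1 hu) fun hd => ?_
    have := hsph u hd
    have := norm_sub_le_norm_sub_add_norm_sub (G u) y (G x)
    rw [norm_sub_rev y] at this
    linarith
  have hy := hG.eq_of_isLocalMin_norm_sub (hunit u)
    (hmin.isLocalMin (mem_of_superset (Metric.isOpen_ball.mem_nhds hball)
      Metric.ball_subset_closedBall))
  rw [← hy]
  exact hsub (Metric.ball_subset_ball hrlt₂.le hball)

theorem LocallyLipschitz.isLocalHomeomorph (hG : LocallyLipschitz G)
    (hunit : ∀ u, ∀ T ∈ convexHull ℝ (limitingFDeriv G u), IsUnit T) : IsLocalHomeomorph G := by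
  rw [isLocalHomeomorph_iff_isOpenEmbedding_restrict]
  intro x
  obtain ⟨r, hr, hinj⟩ := hG.exists_injOn_ball (hunit x)
  refine ⟨Metric.ball x r, Metric.ball_mem_nhds x hr,
    .of_continuous_injective_isOpenMap ?_ hinj.injective ?_⟩
  · exact hG.continuous.comp continuous_subtype_val
  · exact (IsOpenMap.of_nhds_le (hG.nhds_le_map_nhds hunit)).comp
      Metric.isOpen_ball.isOpenMap_subtype_val

end Local

/-! ### Global inversion by covering maps -/

/-- A proper local homeomorphism is a covering map. -/
theorem IsProperMap.isCoveringMap {X Y : Type*} [TopologicalSpace X] [TopologicalSpace Y]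
    [T2Space X] [T1Space Y] {f : X → Y} (hf : IsProperMap f) (hl : IsLocalHomeomorph f) :
    IsCoveringMap f := by
  rw [isCoveringMap_iff_isCoveringMapOn_univ]
  refine hf.isClosedMap.isCoveringMapOn_of_isLocalHomeomorphOn (fun y _ => ?_)
    (hl.isLocalHomeomorphOn.mono (Set.subset_univ _))
  -- Fibers are compact by properness and discrete by local injectivity.
  refine (hf.isCompact_preimage isCompact_singleton).finite
    (.of_openPartialHomeomorph f subset_rfl fun e _ => ?_)
  obtain ⟨φ, hφ, rfl⟩ := hl e
  exact ⟨φ, hφ, rfl⟩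

/-- A covering map from a connected space onto a simply connected and locally path-connected space
is bijective. -/
theorem IsCoveringMap.bijective {X Y : Type*} [TopologicalSpace X] [TopologicalSpace Y]
    [ConnectedSpace X] [SimplyConnectedSpace Y] [LocallyPathConnectedSpace Y] {f : X → Y}
    (hf : IsCoveringMap f) : Function.Bijective f := by
  obtain ⟨x⟩ : Nonempty X := inferInstance
  -- Lifting the identity gives a section `s`; `s ∘ f` and `id` both lift `f` and agree at `x`, so
  -- they coincide.
  obtain ⟨s, ⟨hsx, hs⟩, -⟩ := hf.existsUnique_continuousMap_lifts (.id Y) (f x) x rfl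
  have hsf : s ∘ f = id := hf.eq_of_comp_eq (s.continuous.comp hf.continuous) continuous_id
    (by rw [← Function.comp_assoc, hs]; rfl) x hsx
  exact ⟨Function.LeftInverse.injective (congrFun hsf),
    Function.RightInverse.surjective (congrFun hs)⟩

/-- Hadamard's global inverse theorem for locally Lipschitz maps with nonsingular generalized
derivative. -/
theorem LocallyLipschitz.bijective_of_tendsto_cocompact {E : Type*} [NormedAddCommGroup E]
    [InnerProductSpace ℝ E] [FiniteDimensional ℝ E] {G : E → E} (hG : LocallyLipschitz G)
    (hunit : ∀ u, ∀ T ∈ convexHull ℝ (limitingFDeriv G u), IsUnit T)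
    (hcoc : Tendsto G (cocompact E) (cocompact E)) : Function.Bijective G := by
  have : ProperSpace E := FiniteDimensional.proper ℝ E
  exact ((isProperMap_iff_tendsto_cocompact.2 ⟨hG.continuous, hcoc⟩).isCoveringMap
    (hG.isLocalHomeomorph hunit)).bijective

/-! ### From matrices to operators -/

section Jacobian

variable {N : ℕ}

theorem jacobianMatrix_eq_toEuclideanCLM_symm
    (F : EuclideanSpace ℝ (Fin N) → EuclideanSpace ℝ (Fin N)) (u : EuclideanSpace ℝ (Fin N)) :
    jacobianMatrix F u = (Matrix.toEuclideanCLM (n := Fin N) (𝕜 := ℝ)).symm (fderiv ℝ F u) := by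
  obtain ⟨B, hB⟩ : ∃ B, Matrix.toEuclideanCLM (n := Fin N) (𝕜 := ℝ) B = fderiv ℝ F u :=
    (Matrix.toEuclideanCLM (n := Fin N) (𝕜 := ℝ)).surjective (fderiv ℝ F u)
  rw [← hB, StarAlgEquiv.symm_apply_apply]
  ext i j
  rw [jacobianMatrix, ← hB]
  simp [Matrix.ofLp_toEuclideanCLM]

theorem isUnit_of_mem_convexHull_limitingFDeriv (A : Matrix (Fin N) (Fin N) ℝ)
    {F : EuclideanSpace ℝ (Fin N) → EuclideanSpace ℝ (Fin N)} {x : EuclideanSpace ℝ (Fin N)}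
    (hdet : ∀ B ∈ generalizedJacobian F x, (A - B).det ≠ 0)
    {T : EuclideanSpace ℝ (Fin N) →L[ℝ] EuclideanSpace ℝ (Fin N)}
    (hT : T ∈ convexHull ℝ (limitingFDeriv (fun u => Matrix.toEuclideanCLM (𝕜 := ℝ) A u - F u) x)) :
    IsUnit T := by
  let e := Matrix.toEuclideanCLM (n := Fin N) (𝕜 := ℝ)
  let M : (EuclideanSpace ℝ (Fin N) →L[ℝ] EuclideanSpace ℝ (Fin N)) →ₗ[ℝ]
    Matrix (Fin N) (Fin N) ℝ := e.symm.toAlgEquiv.toLinearMap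
  have hMe (S) : M S = e.symm S := rfl
  let Φ : (EuclideanSpace ℝ (Fin N) →L[ℝ] EuclideanSpace ℝ (Fin N)) →ᵃ[ℝ]
    Matrix (Fin N) (Fin N) ℝ := AffineMap.const ℝ _ A - M.toAffineMap
  have hΦ (S) : Φ S = A - M S := rfl
  -- The affine map `S ↦ A - S` commutes with convex hulls and sends limiting derivatives of `A - F`
  -- to limiting Jacobians of `F`.
  have hmem : Φ T ∈ generalizedJacobian F x := by
    have himg := Set.mem_image_of_mem Φ hT
    rw [Φ.image_convexHull] at himg
    refine convexHull_mono ?_ himg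
    rintro _ ⟨S, hS, rfl⟩
    obtain ⟨u, hd, hu, hlim⟩ := exists_seq_of_mem_limitingFDeriv hS
    have hF (k : ℕ) : HasFDerivAt F
        (e A - fderiv ℝ (fun u => Matrix.toEuclideanCLM (𝕜 := ℝ) A u - F u) (u k)) (u k) := by
      refine ((e A).hasFDerivAt.sub (hd k).hasFDerivAt).congr_of_eventuallyEq
        (Eventually.of_forall fun u => ?_)
      exact (sub_sub_cancel (e A u) (F u)).symm
    refine ⟨u, fun k => (hF k).differentiableAt, hu, ?_⟩
    have hJ (k : ℕ) : jacobianMatrix F (u k) =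
        A - M (fderiv ℝ (fun u => Matrix.toEuclideanCLM (𝕜 := ℝ) A u - F u) (u k)) := by
      rw [jacobianMatrix_eq_toEuclideanCLM_symm, (hF k).fderiv, map_sub, hMe]
      congr 1
      exact e.symm_apply_apply A
    simp only [hJ, hΦ]
    exact tendsto_const_nhds.sub
      ((LinearMap.continuous_of_finiteDimensional M).continuousAt.tendsto.comp hlim)
  have h := hdet _ hmem
  rw [hΦ, sub_sub_cancel, hMe, ← isUnit_iff_ne_zero, ← Matrix.isUnit_iff_isUnit_det] at h
  simpa using h.map e

end Jacobian

/-! ### Spectral lower bound and conclusion -/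

/-- The smallest eigenvalue of a symmetric operator bounds its quadratic form from below. -/
theorem LinearMap.IsSymmetric.mul_norm_sq_le_inner {E : Type*} [NormedAddCommGroup E]
    [InnerProductSpace ℝ E] [FiniteDimensional ℝ E] {T : E →ₗ[ℝ] E} (hT : T.IsSymmetric) {l : ℝ}
    (hl : ∀ μ, Module.End.HasEigenvalue T μ → l ≤ μ) (x : E) : l * ‖x‖ ^ 2 ≤ inner ℝ (T x) x := by
  let b := hT.eigenvectorBasis rfl
  rw [← b.sum_inner_mul_inner (T x) x, ← b.sum_sq_norm_inner_right x, Finset.mul_sum]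
  refine Finset.sum_le_sum fun i _ => ?_
  have hle := hl _ (hT.hasEigenvalue_eigenvalues rfl i)
  have hb : T (b i) = hT.eigenvalues rfl i • b i := hT.apply_eigenvectorBasis rfl i
  rw [hT, hb, inner_smul_right, real_inner_comm x, Real.norm_eq_abs, sq_abs, mul_assoc, ← sq]
  exact mul_le_mul_of_nonneg_right hle (sq_nonneg _)

theorem Matrix.sqrt_mul_norm_le_norm_toEuclideanCLM {N : ℕ} {A : Matrix (Fin N) (Fin N) ℝ} {l : ℝ}
    (hl : ∀ μ, Module.End.HasEigenvalue (Matrix.toLin' (A.transpose * A)) μ → l ≤ μ)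
    (x : EuclideanSpace ℝ (Fin N)) :
    Real.sqrt l * ‖x‖ ≤ ‖Matrix.toEuclideanCLM (𝕜 := ℝ) A x‖ := by
  have hsymm : (Matrix.toEuclideanLin (A.transpose * A)).IsSymmetric := by
    rw [Matrix.isSymmetric_toEuclideanLin_iff]
    exact Matrix.isHermitian_conjTranspose_mul_self A
  have h := hsymm.mul_norm_sq_le_inner (l := l) (fun μ hμ => hl μ ?_) x
  · have hinner : inner ℝ (Matrix.toEuclideanLin (A.transpose * A) x) x =
        ‖Matrix.toEuclideanCLM (𝕜 := ℝ) A x‖ ^ 2 := by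
      rw [← real_inner_self_eq_norm_sq, Matrix.inner_toEuclideanCLM, Matrix.ofLp_toEuclideanCLM,
        real_inner_comm, ← Matrix.coe_toEuclideanCLM_eq_toEuclideanLin,
        ContinuousLinearMap.coe_coe, Matrix.inner_toEuclideanCLM, ← Matrix.mulVec_mulVec,
        Matrix.dotProduct_mulVec, Matrix.vecMul_transpose]
    rw [hinner] at h
    have := Real.sqrt_le_sqrt h
    rwa [Real.sqrt_mul' l (sq_nonneg _), Real.sqrt_sq (norm_nonneg _),
      Real.sqrt_sq (norm_nonneg _)] at this
  · obtain ⟨v, hv⟩ := hμ.exists_hasEigenvector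
    refine Module.End.hasEigenvalue_of_hasEigenvector (x := v.ofLp) ?_
    rw [Module.End.hasEigenvector_iff, Module.End.mem_eigenspace_iff]
    refine ⟨?_, by simpa using hv.2⟩
    exact congrArg WithLp.ofLp hv.apply_eq_smul

theorem theorem7 {N : ℕ} (A : Matrix (Fin N) (Fin N) ℝ)
    (hA : (Matrix.transpose A * A).PosDef)
    (lam₁ : ℝ)
    (hlam₁ : IsLeast
      {μ : ℝ | Module.End.HasEigenvalue (Matrix.toLin' (Matrix.transpose A * A)) μ} lam₁)
    (F : EuclideanSpace ℝ (Fin N) → EuclideanSpace ℝ (Fin N))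
    (hF : LocallyLipschitz F)
    (hgrowth : ∃ a : ℝ, 0 < a ∧ a < Real.sqrt lam₁ ∧
      ∃ R : ℝ, ∀ x : EuclideanSpace ℝ (Fin N), R ≤ ‖x‖ → ‖F x‖ ≤ a * ‖x‖)
    (hdet : ∀ x : EuclideanSpace ℝ (Fin N), ∀ B ∈ generalizedJacobian F x, (A - B).det ≠ 0) :
    ∀ ξ : EuclideanSpace ℝ (Fin N),
      ∃! x : EuclideanSpace ℝ (Fin N), Matrix.toEuclideanLin A x = F x + ξ := by
  intro ξ
  obtain ⟨a, -, ha, R, hR⟩ := hgrowth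
  have hG : LocallyLipschitz fun u => Matrix.toEuclideanCLM (𝕜 := ℝ) A u - F u :=
    (Matrix.toEuclideanCLM (𝕜 := ℝ) A).lipschitz.locallyLipschitz.sub hF
  have hcoc : Tendsto (fun u => Matrix.toEuclideanCLM (𝕜 := ℝ) A u - F u)
      (cocompact (EuclideanSpace ℝ (Fin N))) (cocompact _) := by
    rw [← Metric.cobounded_eq_cocompact, ← tendsto_norm_atTop_iff_cobounded]
    have hlin : Tendsto (fun u : EuclideanSpace ℝ (Fin N) => (Real.sqrt lam₁ - a) * ‖u‖)
        (Bornology.cobounded _) atTop :=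
      tendsto_norm_cobounded_atTop.const_mul_atTop (sub_pos.2 ha)
    refine tendsto_atTop_mono' _ ?_ hlin
    filter_upwards [tendsto_norm_cobounded_atTop.eventually_ge_atTop R] with u hu
    have h1 := Matrix.sqrt_mul_norm_le_norm_toEuclideanCLM (fun μ hμ => hlam₁.2 hμ) u
    have h2 := norm_sub_norm_le (Matrix.toEuclideanCLM (𝕜 := ℝ) A u) (F u)
    linarith [hR u hu]
  have hbij := hG.bijective_of_tendsto_cocompact
    (fun u T hT => isUnit_of_mem_convexHull_limitingFDeriv A (hdet u) hT) hcoc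
  simpa only [sub_eq_iff_eq_add'] using! hbij.existsUnique ξ
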